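/- Let $\alpha>2$, $\lambda>0$, $\beta>0$, let $x_{\rm s},x_{\rm r}\in\mathbb{R}^2$ with $|x_{\rm s}|\neq|x_{\rm r}|$, and put $\ell(d)=(1+d^{\alpha})^{-1}$ for $d\ge 0$. Let $\{\mathsf x_i\}_{i\ge 0}$ be a stationary Poisson point process in $\mathbb{R}^2$ with density $\lambda$, and let $\mathsf u_{\rm sr},\mathsf u_{\rm sd},\mathsf u_{\rm rd}$ and $\mathsf g_i,\mathsf h_i$ ($i\ge 0$) be mutually independent exponentially distributed random variables with a common mean, independent of $\{\mathsf x_i\}$. Put $\mathsf I_{\rm r}=\sum_i \mathsf g_i\,\ell(|\mathsf x_i-x_{\rm r}|)$, $\mathsf I_{\rm d}=\sum_i \mathsf h_i\,\ell(|\mathsf x_i|)$, $$\mathsf{SIR}_{\rm sr}=\frac{\mathsf u_{\rm sr}\ell(|x_{\rm s}-x_{\rm r}|)}{\mathsf I_{\rm r}},\qquad \mathsf{SIR}_{\rm srd}=\frac{\mathsf u_{\rm sd}\ell(|x_{\rm s}|)+\mathsf u_{\rm rd}\ell(|x_{\rm r}|)}{\mathsf I_{\rm d}},\qquad \mathsf{SIR}_{\rm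 sd}=\frac{2\mathsf u_{\rm sd}\ell(|x_{\rm s}|)}{\mathsf I_{\rm d}},$$ and define the outage probabilities of the broadcast phase and of the MAC phase by $$q_{\rm BC}=\mathbb P(\mathsf{SIR}_{\rm sd}<\beta,\ \mathsf{SIR}_{\rm sr}<\beta),\qquad q_{\rm MAC}=\mathbb P(\mathsf{SIR}_{\rm srd}<\beta,\ \mathsf{SIR}_{\rm sr}\ge\beta).$$ Let $$\ell^*_{\rm sd}(r)=\frac{1+|x_{\rm s}|^\alpha}{1+r^\alpha},\quad \ell^*_{\rm rd}(r)=\frac{1+|x_{\rm r}|^\alpha}{1+r^\alpha},\quad \ell^*_{\rm sr}(r,\phi)=\frac{1+|x_{\rm s}-x_{\rm r}|^\alpha}{1+(r^2+|x_{\rm r}|^2-2r|x_{\rm r}|\cos\phi)^{\alpha/2}},$$ $$\mu_1=\frac{\ell(|x_{\rm s}|)}{\ell(|x_{\rm s}|)-\ell(|x_{\rm r}|)},\qquad \mu_2=\frac{\ell(|x_{\rm r}|)}{\ell(|x_{\rm s}|)-\ell(|x_{\rm r}|)},$$ $$\Psi(f,g)=\int_0^\infty\!\int_0^\pi 2r\Big(1-\frac{1}{(1+f(r,\phi))(1+g(r))}\Big)\,d\phi\,dr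 .$$ Then all the integrals $\Psi$ below converge absolutely, and $$q_{\rm BC}=1-e^{-\lambda\Psi(0,\frac{\beta}{2}\ell^*_{\rm sd})}-e^{-\lambda\Psi(\beta\ell^*_{\rm sr},0)}+e^{-\lambda\Psi(\beta\ell^*_{\rm sr},\frac{\beta}{2}\ell^*_{\rm sd})},$$ $$q_{\rm MAC}=e^{-\lambda\Psi(\beta\ell^*_{\rm sr},0)}-\mu_1e^{-\lambda\Psi(\beta\ell^*_{\rm sr},\beta\ell^*_{\rm sd})}+\mu_2e^{-\lambda\Psi(\beta\ell^*_{\rm sr},\beta\ell^*_{\rm rd})}.$$ -/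

import Mathlib

open MeasureTheory ProbabilityTheory
open scoped ENNReal NNReal

noncomputable section

namespace SDF

/-- The Euclidean plane. -/
abbrev Plane := EuclideanSpace ℝ (Fin 2)

/-- A random measure `Φ` on `E` is a Poisson point process with intensity measure `Λ`: the number
of points in a measurable set of finite intensity is Poisson distributed with mean `Λ A`, and the
numbers of points in finitely many pairwise disjoint measurable sets are independent. -/
structure IsPoissonPointProcess {Ω E : Type*} [MeasurableSpace Ω] [MeasurableSpace E]
    (P : Measure Ω) (Φ : Ω → Measure E) (Λ : Measure E) : Prop where
  measurable : ∀ A : Set E, MeasurableSet A → Measurable fun ω => Φ ω A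
  poisson : ∀ A : Set E, MeasurableSet A → Λ A ≠ ∞ →
    P.map (fun ω => Φ ω A) = (poissonMeasure (Λ A).toNNReal).map (fun n : ℕ => (n : ℝ≥0∞))
  indep : ∀ (n : ℕ) (A : Fin n → Set E), (∀ j, MeasurableSet (A j)) →
    Pairwise (fun j k => Disjoint (A j) (A k)) → iIndepFun (fun j ω => Φ ω (A j)) P

/-- The point configuration `{x₀, x₁, …}` as a counting measure. -/
def pointProcess {Ω E : Type*} [MeasurableSpace E] (x : ℕ → Ω → E) (ω : Ω) : Measure E :=
  Measure.sum fun i => Measure.dirac (x i ω)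

/-- The wireless links: source-relay, source-destination, relay-destination, and from the `i`-th
interferer to the relay and to the destination. -/
inductive Link where
  | sr : Link
  | sd : Link
  | rd : Link
  | toRelay : ℕ → Link
  | toDest : ℕ → Link

/-- All fading gains, as one family of random variables indexed by the links. -/
def gains {Ω : Type*} (usr usd urd : Ω → ℝ) (g h : ℕ → Ω → ℝ) : Link → Ω → ℝ
  | .sr => usr
  | .sd => usd
  | .rd => urd
  | .toRelay i => g i
  | .toDest i => h i

/-- The probabilistic model: the interferer locations form a stationary Poisson point process in
the plane with density `lam`; all fading gains are i.i.d. exponential (with rate `η`), and they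
are independent of the interferer locations. -/
structure IsRayleighNetwork {Ω : Type*} [MeasurableSpace Ω] (P : Measure Ω) (lam η : ℝ)
    (x : ℕ → Ω → Plane) (usr usd urd : Ω → ℝ) (g h : ℕ → Ω → ℝ) : Prop where
  measurable_location : ∀ i, Measurable (x i)
  poisson : IsPoissonPointProcess P (pointProcess x) (ENNReal.ofReal lam • volume)
  measurable_gain : ∀ k, Measurable (gains usr usd urd g h k)
  exponential : ∀ k, P.map (gains usr usd urd g h k) = expMeasure η
  indep_gains : iIndepFun (gains usr usd urd g h) P
  indep_location : IndepFun (fun ω i => x i ω) (fun ω k => gains usr usd urd g h k ω) P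

/-- The path loss function `ℓ(d) = 1 / (1 + d ^ α)`. -/
def pathLoss (α d : ℝ) : ℝ := (1 + d ^ α)⁻¹

section Model

variable {Ω : Type*} (α : ℝ)

/-- The interference at the location `y`, where `f i` is the fading gain from the `i`-th
interferer to `y`. -/
def interference (x : ℕ → Ω → Plane) (f : ℕ → Ω → ℝ) (y : Plane) (ω : Ω) : ℝ≥0∞ :=
  ∑' i, ENNReal.ofReal (f i ω * pathLoss α ‖x i ω - y‖)

/-- The SIR at the relay. -/
def SIRsr (xs xr : Plane) (x : ℕ → Ω → Plane) (usr : Ω → ℝ) (g : ℕ → Ω → ℝ) (ω : Ω) : ℝ≥0∞ :=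
  ENNReal.ofReal (usr ω * pathLoss α ‖xs - xr‖) / interference α x g xr ω

/-- The SIR at the destination (the origin) after combining the copies of source and relay. -/
def SIRsrd (xs xr : Plane) (x : ℕ → Ω → Plane) (usd urd : Ω → ℝ) (h : ℕ → Ω → ℝ) (ω : Ω) : ℝ≥0∞ :=
  ENNReal.ofReal (usd ω * pathLoss α ‖xs‖ + urd ω * pathLoss α ‖xr‖) / interference α x h 0 ω

/-- The SIR at the destination (the origin) when the source re-transmits. -/
def SIRsd (xs : Plane) (x : ℕ → Ω → Plane) (usd : Ω → ℝ) (h : ℕ → Ω → ℝ) (ω : Ω) : ℝ≥0∞ :=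
  ENNReal.ofReal (2 * usd ω * pathLoss α ‖xs‖) / interference α x h 0 ω

variable [MeasurableSpace Ω] (P : Measure Ω)

/-- The outage probability `ℙ(SIR_sd < β, SIR_sr < β)` of the broadcast phase. -/
def qBC (β : ℝ) (xs xr : Plane) (x : ℕ → Ω → Plane) (usr usd : Ω → ℝ) (g h : ℕ → Ω → ℝ) : ℝ :=
  P.real {ω | SIRsd α xs x usd h ω < ENNReal.ofReal β ∧
    SIRsr α xs xr x usr g ω < ENNReal.ofReal β}

/-- The outage probability `ℙ(SIR_srd < β, SIR_sr ≥ β)` of the MAC phase. -/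
def qMAC (β : ℝ) (xs xr : Plane) (x : ℕ → Ω → Plane) (usr usd urd : Ω → ℝ) (g h : ℕ → Ω → ℝ) : ℝ :=
  P.real {ω | SIRsrd α xs xr x usd urd h ω < ENNReal.ofReal β ∧
    ENNReal.ofReal β ≤ SIRsr α xs xr x usr g ω}

end Model

/-- `ℓ*_sd(r)`. -/
def lsd (α : ℝ) (xs : Plane) (r : ℝ) : ℝ := (1 + ‖xs‖ ^ α) / (1 + r ^ α)

/-- `ℓ*_rd(r)`. -/
def lrd (α : ℝ) (xr : Plane) (r : ℝ) : ℝ := (1 + ‖xr‖ ^ α) / (1 + r ^ α)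

/-- `ℓ*_sr(r, φ)`. -/
def lsr (α : ℝ) (xs xr : Plane) (r φ : ℝ) : ℝ :=
  (1 + ‖xs - xr‖ ^ α) / (1 + (r ^ 2 + ‖xr‖ ^ 2 - 2 * r * ‖xr‖ * Real.cos φ) ^ (α / 2))

/-- The integrand of `Ψ(f, g)`. -/
def psiIntegrand (f : ℝ → ℝ → ℝ) (g : ℝ → ℝ) (r φ : ℝ) : ℝ :=
  2 * r * (1 - 1 / ((1 + f r φ) * (1 + g r)))

/-- `Ψ(f, g) = ∫₀^∞ ∫₀^π 2 r (1 - 1 / ((1 + f(r, φ)) (1 + g(r)))) dφ dr`. -/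
def Psi (f : ℝ → ℝ → ℝ) (g : ℝ → ℝ) : ℝ :=
  ∫ r in Set.Ioi (0 : ℝ), ∫ φ in (0 : ℝ)..Real.pi, psiIntegrand f g r φ

/-- The double integral `Ψ(f, g)` converges absolutely. -/
def PsiConverges (f : ℝ → ℝ → ℝ) (g : ℝ → ℝ) : Prop :=
  IntegrableOn (fun p : ℝ × ℝ => psiIntegrand f g p.1 p.2)
    (Set.Ioi (0 : ℝ) ×ˢ Set.Ioc (0 : ℝ) Real.pi)

/-- The coefficient `μ₁`. -/
def mu1 (α : ℝ) (xs xr : Plane) : ℝ :=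
  pathLoss α ‖xs‖ / (pathLoss α ‖xs‖ - pathLoss α ‖xr‖)

/-- The coefficient `μ₂`. -/
def mu2 (α : ℝ) (xs xr : Plane) : ℝ :=
  pathLoss α ‖xr‖ / (pathLoss α ‖xs‖ - pathLoss α ‖xr‖)

end SDF

end

namespace SDF

open Filter Topology

/-! Up to a null set, both outage events are Boolean combinations of success events: R (relay
decodes), D (direct retransmission) and C (combined copies). Hence q_BC = 1 - P(R) - P(D) + P(R ∩ D)
and q_MAC = P(R) - P(R ∩ C).

The link gains are independent of the interferences, so one can condition on the latter. An
exponential tail turns a success probability into e^{-sI}; for C the tail of a weighted sum of two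
exponentials is μ₁e^{-sI} - μ₂e^{-s'I}, with distinct weights because |x_s| ≠ |x_r|
(`expMeasure_prod_le_ofReal_add`). Everything thus reduces to the joint Laplace transform of the two
interferences, `lintegral_expNeg_interference`.

Given the locations, averaging over the fading gives a product over interferers of `fadingFactor`;
the rate η cancels because the Laplace variables are proportional to η. The Laplace functional of
the Poisson process (`IsPoissonPointProcess.lintegral_expNeg`) turns this product into exp(-λ ∫ (1 -
fadingFactor)). The same points cause both interferences, which is why Ψ has a product inside its
integrand. Polar coordinates identify the plane integral with Ψ (`lintegral_one_sub_fadingFactor`),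
and its finiteness, from α > 2, gives absolute convergence.

Interferences take values in [0, ∞]; with e^{-∞} = 0 their almost sure finiteness is never needed.
-/

/-! ### The exponential on [0, ∞] and the Poisson distribution. -/

/-- The function `a ↦ e⁻ᵃ` on `[0, ∞]`, with value `0` at `∞`. -/
noncomputable def expNeg (a : ℝ≥0∞) : ℝ≥0∞ := EReal.exp (-(a : EReal))

@[simp] lemma expNeg_zero : expNeg 0 = 1 := by simp [expNeg]

@[simp] lemma expNeg_top : expNeg ∞ = 0 := by simp [expNeg]

lemma expNeg_add (a b : ℝ≥0∞) : expNeg (a + b) = expNeg a * expNeg b := by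
  simp only [expNeg]
  rw [EReal.coe_ennreal_add, EReal.neg_add (by simp) (by simp), sub_eq_add_neg, EReal.exp_add]

lemma expNeg_ofReal {t : ℝ} (ht : 0 ≤ t) :
    expNeg (ENNReal.ofReal t) = ENNReal.ofReal (Real.exp (-t)) := by
  simp only [expNeg]
  rw [EReal.coe_ennreal_ofReal, max_eq_left ht, ← EReal.coe_neg, EReal.exp_coe]

lemma continuous_expNeg : Continuous expNeg :=
  ENNReal.continuous_exp.comp (continuous_neg.comp continuous_coe_ennreal_ereal)

@[fun_prop] lemma measurable_expNeg : Measurable expNeg := continuous_expNeg.measurable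

lemma antitone_expNeg : Antitone expNeg := fun _ _ h =>
  EReal.exp_monotone (EReal.neg_le_neg_iff.2 (EReal.coe_ennreal_le_coe_ennreal_iff.2 h))

lemma expNeg_le_one (a : ℝ≥0∞) : expNeg a ≤ 1 := by
  simpa using antitone_expNeg zero_le

lemma expNeg_ne_top (a : ℝ≥0∞) : expNeg a ≠ ∞ :=
  ((expNeg_le_one a).trans_lt ENNReal.one_lt_top).ne

lemma expNeg_sum {ι : Type*} (s : Finset ι) (f : ι → ℝ≥0∞) :
    expNeg (∑ i ∈ s, f i) = ∏ i ∈ s, expNeg (f i) := by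
  classical
  induction s using Finset.induction_on with
  | empty => simp
  | insert a s ha ih => rw [Finset.sum_insert ha, Finset.prod_insert ha, expNeg_add, ih]

lemma expNeg_mul_natCast (c : ℝ≥0∞) (n : ℕ) : expNeg (c * n) = expNeg c ^ n := by
  have := expNeg_sum (Finset.range n) fun _ => c
  simpa [mul_comm] using this

/-- The Laplace transform of the Poisson distribution. -/
lemma lintegral_expNeg_poissonMeasure (r : ℝ≥0) (c : ℝ≥0∞) :
    ∫⁻ n : ℕ, expNeg (c * n) ∂poissonMeasure r = expNeg (r * (1 - expNeg c)) := by
  obtain ⟨q, hq⟩ : ∃ q : ℝ≥0, expNeg c = q := ⟨_, (ENNReal.coe_toNNReal (expNeg_ne_top c)).symm⟩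
  have hq1 : q ≤ 1 := by exact_mod_cast hq ▸ expNeg_le_one c
  -- With q = e^{-c}, the transform is the Poisson generating function at q, summed by the
  -- exponential series.
  have hs : HasSum (fun n : ℕ => Real.exp (-r) * ((r * q : ℝ) ^ n / n.factorial))
      (Real.exp (-r) * Real.exp (r * q)) := by
    rw [Real.exp_eq_exp_ℝ]
    exact (NormedSpace.expSeries_div_hasSum_exp (r * q : ℝ)).mul_left _
  have hr : (r : ℝ≥0∞) * (1 - q) = ENNReal.ofReal (r * (1 - q)) := by
    rw [ENNReal.ofReal_mul r.coe_nonneg, ENNReal.ofReal_sub _ q.coe_nonneg]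
    simp
  have hq1' : (q : ℝ) ≤ 1 := by exact_mod_cast hq1
  rw [poissonMeasure, lintegral_sum_measure]
  simp_rw [lintegral_smul_measure, lintegral_dirac, expNeg_mul_natCast, hq, hr]
  rw [expNeg_ofReal (mul_nonneg r.coe_nonneg (by linarith)),
    show -((r : ℝ) * (1 - q)) = -r + r * q by ring, Real.exp_add, ← hs.tsum_eq,
    ENNReal.ofReal_tsum_of_nonneg (fun n => by positivity) hs.summable]
  congr 1 with n
  rw [show (q : ℝ≥0∞) = ENNReal.ofReal q by simp, ← ENNReal.ofReal_pow q.coe_nonneg, smul_eq_mul,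
    ← ENNReal.ofReal_mul (by positivity)]
  congr 1
  rw [mul_pow]; ring

/-! ### Laplace functional of a Poisson point process. -/

namespace IsPoissonPointProcess

variable {Ω E : Type*} [MeasurableSpace Ω] [MeasurableSpace E] {P : Measure Ω}
  {Φ : Ω → Measure E} {Λ : Measure E}

lemma lintegral_expNeg_mul_apply (hΦ : IsPoissonPointProcess P Φ Λ) {A : Set E}
    (hA : MeasurableSet A) (hΛ : Λ A ≠ ∞) (c : ℝ≥0∞) :
    ∫⁻ ω, expNeg (c * Φ ω A) ∂P = expNeg (Λ A * (1 - expNeg c)) := by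
  have hm : Measurable fun t : ℝ≥0∞ => expNeg (c * t) := by fun_prop
  rw [← lintegral_map hm (hΦ.measurable A hA), hΦ.poisson A hA hΛ,
    lintegral_map hm (by fun_prop), lintegral_expNeg_poissonMeasure, ENNReal.coe_toNNReal hΛ]

/-- Distinct level sets are disjoint, so their counts are independent Poisson variables and the
expectation factorizes over the values of `f`. -/
lemma lintegral_expNeg_simpleFunc [IsProbabilityMeasure P] (hΦ : IsPoissonPointProcess P Φ Λ)
    (f : SimpleFunc E ℝ≥0∞) (hf : ∀ c ≠ 0, Λ (f ⁻¹' {c}) ≠ ∞) :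
    ∫⁻ ω, expNeg (∫⁻ y, f y ∂Φ ω) ∂P = expNeg (∫⁻ y, (1 - expNeg (f y)) ∂Λ) := by
  have h1 : ∀ ω, ∫⁻ y, f y ∂Φ ω = ∑ c : f.range, (c : ℝ≥0∞) * Φ ω (f ⁻¹' {(c : ℝ≥0∞)}) := by
    intro ω
    rw [SimpleFunc.lintegral_eq_lintegral, SimpleFunc.lintegral,
      ← Finset.sum_coe_sort f.range (fun c => c * Φ ω (f ⁻¹' {c}))]
  have h2 : ∫⁻ y, (1 - expNeg (f y)) ∂Λ =
      ∑ c : f.range, (1 - expNeg c) * Λ (f ⁻¹' {(c : ℝ≥0∞)}) := by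
    have := SimpleFunc.map_lintegral (μ := Λ) (fun c => 1 - expNeg c) f
    rw [← SimpleFunc.lintegral_eq_lintegral] at this
    rw [Finset.sum_coe_sort f.range (fun c => (1 - expNeg c) * Λ (f ⁻¹' {c})), ← this]
    rfl
  have hind : iIndepFun (fun (c : f.range) ω => Φ ω (f ⁻¹' {(c : ℝ≥0∞)})) P := by
    have := hΦ.indep (Fintype.card f.range)
      (fun j => f ⁻¹' {(((Fintype.equivFin f.range).symm j : f.range) : ℝ≥0∞)})
      (fun j => f.measurableSet_fiber _) (fun j k hjk => by
        refine Disjoint.preimage _ (Set.disjoint_singleton.2 fun h => hjk ?_)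
        exact (Fintype.equivFin f.range).symm.injective (Subtype.ext h))
    simpa using this.precomp (Fintype.equivFin f.range).injective
  have hind' := hind.comp (fun c t => expNeg (c * t)) (fun c => by fun_prop)
  simp_rw [h1, h2, expNeg_sum]
  rw [lintegral_prod_eq_prod_lintegral_of_indepFun Finset.univ
    (fun (c : f.range) ω => expNeg (c * Φ ω (f ⁻¹' {(c : ℝ≥0∞)}))) hind'
    (fun c => measurable_expNeg.comp ((hΦ.measurable _ (f.measurableSet_fiber _)).const_mul _))]
  refine Finset.prod_congr rfl fun c _ => ?_
  -- The zero level may have infinite intensity, but its factor is 1 on both sides.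
  by_cases hc : (c : ℝ≥0∞) = 0
  · simp [hc]
  · rw [hΦ.lintegral_expNeg_mul_apply (f.measurableSet_fiber _) (hf _ hc), mul_comm]

/-- The Laplace functional of a Poisson point process. -/
theorem lintegral_expNeg [IsProbabilityMeasure P] [SigmaFinite Λ]
    (hΦ : IsPoissonPointProcess P Φ Λ) {F : E → ℝ≥0∞} (hF : Measurable F) :
    ∫⁻ ω, expNeg (∫⁻ y, F y ∂Φ ω) ∂P = expNeg (∫⁻ y, (1 - expNeg (F y)) ∂Λ) := by
  -- Cutting off outside sets of finite intensity makes every nonzero level set finite, and the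
  -- approximation stays monotone.
  set f : ℕ → SimpleFunc E ℝ≥0∞ := fun n => (SimpleFunc.eapprox F n).restrict (spanningSets Λ n)
  have hfa : ∀ n y, f n y = (spanningSets Λ n).indicator (SimpleFunc.eapprox F n) y := fun n y =>
    SimpleFunc.restrict_apply _ (measurableSet_spanningSets Λ n) y
  have hmono : ∀ y, Monotone fun n => f n y := by
    intro y m n hmn
    simp only [hfa]
    refine (Set.indicator_le_indicator_of_subset (monotone_spanningSets Λ hmn)
      (fun _ => zero_le) y).trans ?_
    exact Set.indicator_le_indicator (SimpleFunc.monotone_eapprox F hmn y)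
  have hlim : ∀ y, Tendsto (fun n => f n y) atTop (𝓝 (F y)) := by
    intro y
    refine (SimpleFunc.tendsto_eapprox hF y).congr' ?_
    filter_upwards [eventually_ge_atTop (spanningSetsIndex Λ y)] with n hn
    rw [hfa, Set.indicator_of_mem]
    exact mem_spanningSets_of_index_le Λ y hn
  have hfin : ∀ n, ∀ c ≠ 0, Λ (f n ⁻¹' {c}) ≠ ∞ := by
    intro n c hc
    refine ((measure_mono fun y hy => ?_).trans_lt (measure_spanningSets_lt_top Λ n)).ne
    by_contra hy'
    rw [Set.mem_preimage, Set.mem_singleton_iff, hfa, Set.indicator_of_notMem hy'] at hy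
    exact hc hy.symm
  have hL : Tendsto (fun n => ∫⁻ ω, expNeg (∫⁻ y, f n y ∂Φ ω) ∂P) atTop
      (𝓝 (∫⁻ ω, expNeg (∫⁻ y, F y ∂Φ ω) ∂P)) := by
    refine tendsto_lintegral_of_dominated_convergence (fun _ => 1) (fun n => ?_)
      (fun n => ae_of_all _ fun ω => expNeg_le_one _) (by simp) (ae_of_all _ fun ω => ?_)
    · refine measurable_expNeg.comp ?_
      simp_rw [SimpleFunc.lintegral_eq_lintegral, SimpleFunc.lintegral]
      exact Finset.measurable_fun_sum _ fun c _ =>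
        (hΦ.measurable _ ((f n).measurableSet_fiber _)).const_mul _
    · exact (continuous_expNeg.tendsto _).comp (lintegral_tendsto_of_tendsto_of_monotone
        (fun n => (f n).measurable.aemeasurable) (ae_of_all _ hmono) (ae_of_all _ hlim))
  have hR : Tendsto (fun n => expNeg (∫⁻ y, (1 - expNeg (f n y)) ∂Λ)) atTop
      (𝓝 (expNeg (∫⁻ y, (1 - expNeg (F y)) ∂Λ))) := by
    refine (continuous_expNeg.tendsto _).comp (lintegral_tendsto_of_tendsto_of_monotone
      (fun n => ?_) (ae_of_all _ fun y m n hmn => ?_) (ae_of_all _ fun y => ?_))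
    · exact ((measurable_expNeg.comp (f n).measurable).const_sub 1).aemeasurable
    · exact tsub_le_tsub_left (antitone_expNeg (hmono y hmn)) 1
    · exact ENNReal.Tendsto.sub tendsto_const_nhds ((continuous_expNeg.tendsto _).comp (hlim y))
        (Or.inl ENNReal.one_ne_top)
  refine tendsto_nhds_unique hL (hR.congr fun n => ?_)
  exact (hΦ.lintegral_expNeg_simpleFunc (f n) (hfin n)).symm

end IsPoissonPointProcess

lemma toReal_expNeg_ofReal {t : ℝ} (ht : 0 ≤ t) :
    (expNeg (ENNReal.ofReal t)).toReal = Real.exp (-t) := by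
  rw [expNeg_ofReal ht, ENNReal.toReal_ofReal (Real.exp_pos _).le]

/-! ### Tails and Laplace transforms of exponential variables. -/

section Exponential

variable {η : ℝ}

lemma lintegral_expMeasure (f : ℝ → ℝ≥0∞) :
    ∫⁻ u, f u ∂expMeasure η =
      ∫⁻ u in Set.Ioi 0, ENNReal.ofReal (η * Real.exp (-(η * u))) * f u := by
  have hm : Measurable (gammaPDF 1 η) := (measurable_gammaPDFReal 1 η).ennreal_ofReal
  have : ∫⁻ u, f u ∂expMeasure η = ∫⁻ u, exponentialPDF η u * f u := by
    rw [expMeasure, gammaMeasure, lintegral_withDensity_eq_lintegral_mul_non_measurable _ hm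
      (ae_of_all _ fun u => ENNReal.ofReal_lt_top)]
    rfl
  rw [this, ← lintegral_indicator measurableSet_Ioi]
  refine lintegral_congr_ae ?_
  filter_upwards [Measure.ae_ne volume (0 : ℝ)] with u hu
  rcases lt_or_gt_of_ne hu with h | h
  · rw [Set.indicator_of_notMem (by simpa using h.le), exponentialPDF_of_neg h, zero_mul]
  · rw [Set.indicator_of_mem (by simpa using h), exponentialPDF_of_nonneg h.le]

lemma lintegral_Ioi_const_mul_exp {k c : ℝ} (C : ℝ) (hC : 0 ≤ C) (hk : 0 < k) :
    ∫⁻ u in Set.Ioi c, ENNReal.ofReal (C * Real.exp (-(k * u))) =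
      ENNReal.ofReal (C / k * Real.exp (-(k * c))) := by
  have hint := (integrableOn_exp_mul_Ioi (neg_neg_of_pos hk) c).const_mul C
  simp only [neg_mul] at hint
  rw [← ofReal_integral_eq_lintegral_ofReal hint (ae_of_all _ fun u => by positivity),
    integral_const_mul]
  have := integral_exp_mul_Ioi (neg_neg_of_pos hk) c
  simp only [neg_mul] at this
  rw [this]
  congr 1
  field_simp

lemma expMeasure_Ici (hη : 0 < η) (c : ℝ) :
    expMeasure η (Set.Ici c) = ENNReal.ofReal (Real.exp (-(η * max c 0))) := by
  rw [← lintegral_indicator_one measurableSet_Ici, lintegral_expMeasure]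
  have h : ∫⁻ u in Set.Ioi 0, ENNReal.ofReal (η * Real.exp (-(η * u))) *
      (Set.Ici c).indicator 1 u =
      ∫⁻ u in Set.Ioi (max c 0), ENNReal.ofReal (η * Real.exp (-(η * u))) := by
    rw [← lintegral_indicator measurableSet_Ioi, ← lintegral_indicator measurableSet_Ioi]
    refine lintegral_congr_ae ?_
    filter_upwards [Measure.ae_ne volume c] with u hu
    by_cases h0 : 0 < u <;> by_cases h1 : c < u
    · simp [h0, h1, h1.le]
    · have : ¬ c ≤ u := fun h => h1 (lt_of_le_of_ne h (Ne.symm hu))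
      simp [h1, this]
    · simp [h0]
    · simp [h0]
  rw [h, lintegral_Ioi_const_mul_exp η hη.le hη, div_self hη.ne', one_mul]

lemma ae_expMeasure_pos (hη : 0 < η) : ∀ᵐ u ∂expMeasure η, 0 < u := by
  have := isProbabilityMeasure_expMeasure hη
  have h : expMeasure η (Set.Ioi 0) = 1 := by
    rw [← lintegral_indicator_one measurableSet_Ioi, lintegral_expMeasure]
    rw [setLIntegral_congr_fun measurableSet_Ioi
      (g := fun u => ENNReal.ofReal (η * Real.exp (-(η * u)))) (fun u hu => by simp [hu]),
      lintegral_Ioi_const_mul_exp η hη.le hη]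
    simp [hη.ne']
  rw [← prob_compl_eq_zero_iff measurableSet_Ioi] at h
  exact h

/-- Here `t` will be a multiple of an interference, hence possibly ∞; both sides then vanish. -/
lemma expMeasure_le_ofReal_mul (hη : 0 < η) {a : ℝ} (ha : 0 < a) (t : ℝ≥0∞) :
    expMeasure η {u | t ≤ ENNReal.ofReal (u * a)} = expNeg (ENNReal.ofReal (η / a) * t) := by
  have := isProbabilityMeasure_expMeasure hη
  induction t with
  | top => simp [ENNReal.mul_top, hη, ha]
  | coe t =>
    rw [show (t : ℝ≥0∞) = ENNReal.ofReal t by simp]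
    rcases eq_or_ne t 0 with rfl | ht
    · simp
    have ht' : 0 < (t : ℝ) := by positivity
    have : {u | ENNReal.ofReal t ≤ ENNReal.ofReal (u * a)} = Set.Ici (t / a) := by
      ext u
      simp only [Set.mem_ofPred_eq, Set.mem_Ici, ENNReal.ofReal_le_ofReal_iff', div_le_iff₀ ha,
        not_le.2 ht', or_false]
    rw [this, expMeasure_Ici hη, ← ENNReal.ofReal_mul (by positivity),
      expNeg_ofReal (by positivity), max_eq_left (by positivity)]
    congr 3
    ring

/-- The Laplace transform of the exponential distribution. -/
lemma lintegral_expNeg_expMeasure (hη : 0 < η) {s l : ℝ} (hs : 0 ≤ s) (hl : 0 ≤ l) :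
    ∫⁻ u, expNeg (ENNReal.ofReal (η * s) * ENNReal.ofReal (u * l)) ∂expMeasure η =
      ENNReal.ofReal (1 / (1 + s * l)) := by
  rw [lintegral_expMeasure, setLIntegral_congr_fun measurableSet_Ioi
    (g := fun u => ENNReal.ofReal (η * Real.exp (-(η * (1 + s * l) * u)))),
    lintegral_Ioi_const_mul_exp η hη.le (by positivity)]
  · congr 1
    simp
    field_simp
  · intro u (hu : 0 < u)
    simp only
    rw [← ENNReal.ofReal_mul (by positivity), expNeg_ofReal (by positivity),
      ← ENNReal.ofReal_mul (by positivity), mul_assoc, ← Real.exp_add]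
    congr 3
    ring

/-- The tail of the hypoexponential distribution. -/
lemma expMeasure_prod_le_ofReal_add (hη : 0 < η) {a b : ℝ} (ha : 0 < a) (hb : 0 < b) (hab : a ≠ b)
    (t : ℝ≥0∞) :
    ((expMeasure η).prod (expMeasure η)).real {p | t ≤ ENNReal.ofReal (p.1 * a + p.2 * b)} =
      a / (a - b) * (expNeg (ENNReal.ofReal (η / a) * t)).toReal -
        b / (a - b) * (expNeg (ENNReal.ofReal (η / b) * t)).toReal := by
  have := isProbabilityMeasure_expMeasure hη
  have hab' : a - b ≠ 0 := sub_ne_zero.2 hab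
  induction t with
  | top => simp [ENNReal.mul_top, hη, ha, hb]
  | coe t =>
    rw [show (t : ℝ≥0∞) = ENNReal.ofReal t by simp]
    rcases eq_or_ne t 0 with rfl | ht
    · simp [← sub_div, hab']
    have ht' : 0 < (t : ℝ) := by positivity
    generalize (t : ℝ) = s at ht'
    have hset : {p : ℝ × ℝ | ENNReal.ofReal s ≤ ENNReal.ofReal (p.1 * a + p.2 * b)} =
        {p | s ≤ p.1 * a + p.2 * b} := by
      ext p
      simp only [Set.mem_ofPred_eq, ENNReal.ofReal_le_ofReal_iff', not_le.2 ht', or_false]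
    -- Condition on the first variable. The remaining threshold (s - ua)/b changes sign at u = s/a,
    -- so the outer integral is split there.
    have hsec : ∀ u : ℝ, expMeasure η (Prod.mk u ⁻¹' {p | s ≤ p.1 * a + p.2 * b}) =
        ENNReal.ofReal (Real.exp (-(η * max ((s - u * a) / b) 0))) := by
      intro u
      rw [← expMeasure_Ici hη]
      congr 1
      ext v
      simp only [Set.mem_preimage, Set.mem_ofPred_eq, Set.mem_Ici, div_le_iff₀ hb]
      constructor <;> intro h <;> linarith
    -- Antiderivative of density times tail on 0 < u ≤ s/a; the denominator a - b is where a ≠ b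
    -- enters.
    have hd : ∀ u : ℝ, HasDerivAt
        (fun u => b / (a - b) * Real.exp (-(η * s / b)) * Real.exp (η * (a - b) / b * u))
        (η * Real.exp (-(η * s / b)) * Real.exp (η * (a - b) / b * u)) u := by
      intro u
      have := (((hasDerivAt_id u).const_mul (η * (a - b) / b)).exp).const_mul
        (b / (a - b) * Real.exp (-(η * s / b)))
      convert! this using 1
      simp only [id]
      field_simp
    have hsa : 0 ≤ s / a := by positivity
    have hcont : Continuous fun u : ℝ =>
      η * Real.exp (-(η * s / b)) * Real.exp (η * (a - b) / b * u) := by fun_prop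
    have hI1 : ∫⁻ u in Set.Ioc 0 (s / a), ENNReal.ofReal (η * Real.exp (-(η * u))) *
        ENNReal.ofReal (Real.exp (-(η * max ((s - u * a) / b) 0))) =
        ENNReal.ofReal (b / (a - b) * Real.exp (-(η * s / b)) *
          (Real.exp (η * (a - b) / b * (s / a)) - 1)) := by
      rw [setLIntegral_congr_fun measurableSet_Ioc (g := fun u => ENNReal.ofReal
        (η * Real.exp (-(η * s / b)) * Real.exp (η * (a - b) / b * u))),
        ← ofReal_integral_eq_lintegral_ofReal
          (hcont.integrableOn_Ioc) (ae_of_all _ fun u => by positivity),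
        ← intervalIntegral.integral_of_le hsa,
        intervalIntegral.integral_eq_sub_of_hasDerivAt (fun u _ => hd u)
          (hcont.intervalIntegrable _ _)]
      · simp [mul_sub]
      · intro u hu
        have : 0 ≤ (s - u * a) / b := by
          have := (le_div_iff₀ ha).1 hu.2
          exact div_nonneg (by linarith) hb.le
        simp only
        rw [max_eq_left this, ← ENNReal.ofReal_mul (by positivity), mul_assoc, mul_assoc,
          ← Real.exp_add, ← Real.exp_add]
        congr 3
        field_simp
        ring
    have hI2 : ∫⁻ u in Set.Ioi (s / a), ENNReal.ofReal (η * Real.exp (-(η * u))) *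
        ENNReal.ofReal (Real.exp (-(η * max ((s - u * a) / b) 0))) =
        ENNReal.ofReal (Real.exp (-(η * (s / a)))) := by
      rw [setLIntegral_congr_fun measurableSet_Ioi
        (g := fun u => ENNReal.ofReal (η * Real.exp (-(η * u)))),
        lintegral_Ioi_const_mul_exp η hη.le hη, div_self hη.ne', one_mul]
      intro u (hu : s / a < u)
      have : (s - u * a) / b ≤ 0 := by
        have := (div_lt_iff₀ ha).1 hu
        exact div_nonpos_of_nonpos_of_nonneg (by linarith) hb.le
      simp [max_eq_right this]
    -- Both b/(a - b) and the last factor have the sign of a - b.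
    have hnn : 0 ≤ b / (a - b) * Real.exp (-(η * s / b)) *
          (Real.exp (η * (a - b) / b * (s / a)) - 1) := by
      rcases lt_or_gt_of_ne hab with h | h
      · have h1 : b / (a - b) ≤ 0 := div_nonpos_of_nonneg_of_nonpos hb.le (by linarith)
        have h2 : Real.exp (η * (a - b) / b * (s / a)) ≤ 1 := by
          rw [Real.exp_le_one_iff]
          refine mul_nonpos_of_nonpos_of_nonneg (div_nonpos_of_nonpos_of_nonneg ?_ hb.le) hsa
          exact mul_nonpos_of_nonneg_of_nonpos hη.le (by linarith)
        exact mul_nonneg_of_nonpos_of_nonpos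
          (mul_nonpos_of_nonpos_of_nonneg h1 (Real.exp_pos _).le) (by linarith)
      · have h0 : 0 < a - b := by linarith
        have h2 : 1 ≤ Real.exp (η * (a - b) / b * (s / a)) := Real.one_le_exp (by positivity)
        exact mul_nonneg (by positivity) (by linarith)
    rw [hset, Measure.real, Measure.prod_apply (measurableSet_le (by fun_prop) (by fun_prop))]
    simp_rw [hsec]
    rw [lintegral_expMeasure, ← Set.Ioc_union_Ioi_eq_Ioi hsa, lintegral_union measurableSet_Ioi
      (Set.Ioc_disjoint_Ioi le_rfl), hI1, hI2, ← ENNReal.ofReal_add hnn (Real.exp_pos _).le,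
      ENNReal.toReal_ofReal (by positivity), ← ENNReal.ofReal_mul (by positivity),
      ← ENNReal.ofReal_mul (by positivity), toReal_expNeg_ofReal (by positivity),
      toReal_expNeg_ofReal (by positivity)]
    have he : Real.exp (-(η * s / b)) * Real.exp (η * (a - b) / b * (s / a)) =
        Real.exp (-(η / a * s)) := by
      rw [← Real.exp_add]
      congr 1
      field_simp
      ring
    rw [mul_sub, mul_assoc, he, show η * (s / a) = η / a * s by ring,
      show η * s / b = η / b * s by ring]
    field_simp
    ring

end Exponential

/-! ### Path loss, and Ψ as an integral over the plane. -/

lemma pathLoss_pos (α : ℝ) {d : ℝ} (hd : 0 ≤ d) : 0 < pathLoss α d := by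
  unfold pathLoss; positivity

lemma measurable_pathLoss (α : ℝ) : Measurable (pathLoss α) := by
  unfold pathLoss; fun_prop

lemma pathLoss_injOn {α : ℝ} (hα : 0 < α) : Set.InjOn (pathLoss α) (Set.Ici 0) := by
  intro c hc d hd h
  simp only [pathLoss, inv_inj, add_right_inj] at h
  exact (Real.rpow_left_inj hc hd hα.ne').1 h

lemma pathLoss_le {α d : ℝ} (hα : 0 ≤ α) (hd : 0 ≤ d) :
    pathLoss α d ≤ 2 ^ α * (1 + d) ^ (-α) := by
  have h : (1 + d) ^ α ≤ 2 ^ α * (1 + d ^ α) := by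
    rcases le_total d 1 with h1 | h1
    · calc (1 + d) ^ α ≤ 2 ^ α := Real.rpow_le_rpow (by positivity) (by linarith) hα
        _ ≤ 2 ^ α * (1 + d ^ α) := le_mul_of_one_le_right (by positivity)
            (by linarith [Real.rpow_nonneg hd α])
    · calc (1 + d) ^ α ≤ (2 * d) ^ α := Real.rpow_le_rpow (by positivity) (by linarith) hα
        _ = 2 ^ α * d ^ α := Real.mul_rpow (by positivity) hd
        _ ≤ 2 ^ α * (1 + d ^ α) := by gcongr; linarith
  rw [pathLoss, Real.rpow_neg (by positivity), ← div_eq_mul_inv, inv_eq_one_div,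
    div_le_div_iff₀ (by positivity) (by positivity)]
  linarith

lemma integrable_pathLoss {α : ℝ} (hα : 2 < α) (z : Plane) :
    Integrable fun y : Plane => pathLoss α ‖y - z‖ := by
  have h0 : Integrable fun y : Plane => pathLoss α ‖y‖ := by
    -- The power (1 + |y|)^{-α} is integrable exactly when α exceeds the dimension 2.
    have h := (integrable_one_add_norm (E := Plane) (μ := volume) (r := α)
      (by simpa using hα)).const_mul (2 ^ α)
    refine h.mono' ((measurable_pathLoss α).comp measurable_norm).aestronglyMeasurable
      (ae_of_all _ fun y => ?_)
    rw [Real.norm_of_nonneg (pathLoss_pos α (norm_nonneg y)).le]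
    exact pathLoss_le (by linarith) (norm_nonneg y)
  exact h0.comp_sub_right z

/-- The conditional Laplace transform of the contribution of an interferer at `y` to the
interference at `z` and at the origin, with Laplace variables scaled by `A` and `B`. -/
noncomputable def fadingFactor (α A B : ℝ) (z y : Plane) : ℝ :=
  1 / ((1 + A * pathLoss α ‖y - z‖) * (1 + B * pathLoss α ‖y‖))

section FadingFactor

variable {α A B : ℝ} (z : Plane)

lemma measurable_fadingFactor : Measurable (fadingFactor α A B z) := by
  have := measurable_pathLoss α
  unfold fadingFactor
  fun_prop

lemma fadingFactor_pos (hA : 0 ≤ A) (hB : 0 ≤ B) (y : Plane) : 0 < fadingFactor α A B z y := by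
  have h1 := pathLoss_pos α (norm_nonneg (y - z))
  have h2 := pathLoss_pos α (norm_nonneg y)
  unfold fadingFactor
  positivity

lemma one_sub_one_div_nonneg {u v : ℝ} (hu : 0 ≤ u) (hv : 0 ≤ v) :
    0 ≤ 1 - 1 / ((1 + u) * (1 + v)) := by
  rw [sub_nonneg, div_le_one (by positivity)]
  nlinarith

lemma fadingFactor_le_one (hA : 0 ≤ A) (hB : 0 ≤ B) (y : Plane) : fadingFactor α A B z y ≤ 1 := by
  have h1 := pathLoss_pos α (norm_nonneg (y - z))
  have h2 := pathLoss_pos α (norm_nonneg y)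
  have := one_sub_one_div_nonneg (mul_nonneg hA h1.le) (mul_nonneg hB h2.le)
  unfold fadingFactor
  linarith

/-- For u, v ≥ 0 one has 1 - 1/((1+u)(1+v)) ≤ u + v, so two shifted path losses dominate. -/
lemma lintegral_one_sub_fadingFactor_lt_top (hα : 2 < α) (hA : 0 ≤ A) (hB : 0 ≤ B) :
    ∫⁻ y, ENNReal.ofReal (1 - fadingFactor α A B z y) < ∞ := by
  have h := ((integrable_pathLoss hα z).const_mul A).add
    ((integrable_pathLoss hα 0).const_mul B)
  refine Integrable.lintegral_lt_top (h.mono'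
    ((measurable_fadingFactor z).const_sub 1).aestronglyMeasurable (ae_of_all _ fun y => ?_))
  have h1 : 0 ≤ A * pathLoss α ‖y - z‖ := mul_nonneg hA (pathLoss_pos α (norm_nonneg _)).le
  have h2 : 0 ≤ B * pathLoss α ‖y‖ := mul_nonneg hB (pathLoss_pos α (norm_nonneg _)).le
  rw [Real.norm_of_nonneg (sub_nonneg.2 (fadingFactor_le_one z hA hB y))]
  simp only [fadingFactor, Pi.add_apply, sub_zero]
  generalize A * pathLoss α ‖y - z‖ = u at h1
  generalize B * pathLoss α ‖y‖ = v at h2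
  rw [sub_le_iff_le_add, ← sub_le_iff_le_add', le_div_iff₀ (by positivity)]
  nlinarith [mul_nonneg h1 h2, mul_nonneg (mul_nonneg h1 h2) h1, mul_nonneg (mul_nonneg h1 h2) h2]

/-- A linear isometry from `ℂ` to the plane that sends the positive real axis to the ray
through `z`. -/
lemma exists_linearIsometryEquiv_apply_norm :
    ∃ T : ℂ ≃ₗᵢ[ℝ] Plane, T (‖z‖ : ℂ) = z := by
  let S : ℂ ≃ₗᵢ[ℝ] Plane := Complex.orthonormalBasisOneI.repr
  refine ⟨(rotation (Circle.exp (Complex.arg (S.symm z)))).trans S, ?_⟩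
  rw [LinearIsometryEquiv.trans_apply, rotation_apply, Circle.coe_exp, mul_comm,
    ← S.symm.norm_map z, Complex.norm_mul_exp_arg_mul_I, S.apply_symm_apply]

/-- Law of cosines; it produces the angular term in ℓ*_sr. -/
lemma norm_polarCoord_symm_sub_ofReal (r φ ρ : ℝ) :
    ‖Complex.polarCoord.symm (r, φ) - ρ‖ ^ 2 = r ^ 2 + ρ ^ 2 - 2 * r * ρ * Real.cos φ := by
  rw [Complex.polarCoord_symm_apply, ← Complex.normSq_eq_norm_sq, Complex.normSq_apply]
  simp [-Complex.ofReal_cos, -Complex.ofReal_sin]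
  nlinarith [Real.sin_sq_add_cos_sq φ]

/-- The first argument of `Ψ` that belongs to `fadingFactor α A B z`. -/
noncomputable def radialAngularLoss (α A : ℝ) (z : Plane) (r φ : ℝ) : ℝ :=
  A / (1 + (r ^ 2 + ‖z‖ ^ 2 - 2 * r * ‖z‖ * Real.cos φ) ^ (α / 2))

/-- The second argument of `Ψ` that belongs to `fadingFactor α A B z`. -/
noncomputable def radialLoss (α B r : ℝ) : ℝ := B / (1 + r ^ α)

lemma radialAngularLoss_nonneg (hA : 0 ≤ A) (r φ : ℝ) : 0 ≤ radialAngularLoss α A z r φ := by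
  have := norm_polarCoord_symm_sub_ofReal r φ ‖z‖
  unfold radialAngularLoss
  rw [← this]
  positivity

lemma radialLoss_nonneg (hB : 0 ≤ B) {r : ℝ} (hr : 0 ≤ r) : 0 ≤ radialLoss α B r := by
  unfold radialLoss
  positivity

lemma measurable_psiIntegrand : Measurable fun p : ℝ × ℝ =>
    psiIntegrand (radialAngularLoss α A z) (radialLoss α B) p.1 p.2 := by
  unfold psiIntegrand radialAngularLoss radialLoss
  fun_prop

lemma psiIntegrand_nonneg (hA : 0 ≤ A) (hB : 0 ≤ B) {r : ℝ} (hr : 0 ≤ r) (φ : ℝ) :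
    0 ≤ psiIntegrand (radialAngularLoss α A z) (radialLoss α B) r φ := by
  have := one_sub_one_div_nonneg (radialAngularLoss_nonneg (α := α) z hA r φ)
    (radialLoss_nonneg (α := α) hB hr)
  unfold psiIntegrand
  positivity

lemma fadingFactor_apply_polarCoord_symm {T : ℂ ≃ₗᵢ[ℝ] Plane} (hT : T (‖z‖ : ℂ) = z) {r : ℝ}
    (hr : 0 ≤ r) (φ : ℝ) :
    fadingFactor α A B z (T (Complex.polarCoord.symm (r, φ))) =
      1 / ((1 + radialAngularLoss α A z r φ) * (1 + radialLoss α B r)) := by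
  have h1 : ‖T (Complex.polarCoord.symm (r, φ)) - z‖ ^ α =
      (r ^ 2 + ‖z‖ ^ 2 - 2 * r * ‖z‖ * Real.cos φ) ^ (α / 2) := by
    nth_rw 1 [← hT]
    rw [← map_sub, T.norm_map, ← norm_polarCoord_symm_sub_ofReal, ← Real.rpow_natCast_mul
      (norm_nonneg _)]
    congr 1
    push_cast
    ring
  have h2 : ‖T (Complex.polarCoord.symm (r, φ))‖ = r := by
    rw [T.norm_map, Complex.norm_polarCoord_symm, abs_of_nonneg hr]
  rw [fadingFactor, pathLoss, pathLoss, h1, h2, radialAngularLoss, radialLoss, div_eq_mul_inv A,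
    div_eq_mul_inv B]

/-- Reflection symmetry in the axis through `z` accounts for the range [0, π] and the factor 2 in Ψ.
-/
lemma lintegral_Ioo_neg_pi_pi_of_even {f : ℝ → ℝ≥0∞} (hf : ∀ φ, f (-φ) = f φ) :
    ∫⁻ φ in Set.Ioo (-Real.pi) Real.pi, f φ = 2 * ∫⁻ φ in Set.Ioc 0 Real.pi, f φ := by
  have hneg : ∫⁻ φ in Set.Ioc (-Real.pi) 0, f φ = ∫⁻ φ in Set.Ioc 0 Real.pi, f φ := by
    rw [← (Measure.measurePreserving_neg (volume : Measure ℝ)).setLIntegral_comp_preimage_emb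
      (MeasurableEquiv.neg ℝ).measurableEmbedding f (Set.Ioc 0 Real.pi)]
    simp only [hf, Set.neg_preimage, Set.neg_Ioc, neg_zero]
    exact setLIntegral_congr Ico_ae_eq_Ioc.symm
  rw [setLIntegral_congr Ioo_ae_eq_Ioc,
    ← Set.Ioc_union_Ioc_eq_Ioc (by linarith [Real.pi_pos] : -Real.pi ≤ 0) Real.pi_pos.le,
    lintegral_union measurableSet_Ioc (Set.Ioc_disjoint_Ioc_of_le le_rfl), hneg, two_mul]

lemma lintegral_one_sub_fadingFactor_eq :
    ∫⁻ y, ENNReal.ofReal (1 - fadingFactor α A B z y) =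
      ∫⁻ p in Set.Ioi (0 : ℝ) ×ˢ Set.Ioc (0 : ℝ) Real.pi,
        ENNReal.ofReal (psiIntegrand (radialAngularLoss α A z) (radialLoss α B) p.1 p.2) := by
  obtain ⟨T, hT⟩ := exists_linearIsometryEquiv_apply_norm z
  have hm := (measurable_psiIntegrand (α := α) (A := A) (B := B) z).ennreal_ofReal
  set G : ℝ × ℝ → ℝ≥0∞ := fun p => ENNReal.ofReal p.1 * ENNReal.ofReal
    (1 - 1 / ((1 + radialAngularLoss α A z p.1 p.2) * (1 + radialLoss α B p.1))) with hG
  have hGm : Measurable G := by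
    unfold G radialAngularLoss radialLoss
    fun_prop
  have h1 : ∫⁻ y, ENNReal.ofReal (1 - fadingFactor α A B z y) =
      ∫⁻ p in Set.Ioi (0 : ℝ) ×ˢ Set.Ioo (-Real.pi) Real.pi, G p := by
    -- The isometry preserves volume, so the direction of `z` may be taken as the polar axis.
    rw [← T.measurePreserving.lintegral_comp_emb T.toMeasurableEquiv.measurableEmbedding,
      ← Complex.lintegral_comp_polarCoord_symm, polarCoord_target]
    refine setLIntegral_congr_fun (measurableSet_Ioi.prod measurableSet_Ioo) fun p hp => ?_
    simp only [hG, smul_eq_mul]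
    rw [← fadingFactor_apply_polarCoord_symm z hT (Set.mem_Ioi.1 hp.1).le]
  rw [h1, Measure.volume_eq_prod, ← Measure.prod_restrict, ← Measure.prod_restrict,
    lintegral_prod _ hGm.aemeasurable, lintegral_prod _ hm.aemeasurable]
  refine setLIntegral_congr_fun measurableSet_Ioi fun r hr => ?_
  have hr0 : (0 : ℝ) ≤ r := (Set.mem_Ioi.1 hr).le
  simp only
  rw [lintegral_Ioo_neg_pi_pi_of_even (by simp [hG, radialAngularLoss]),
    ← lintegral_const_mul 2 (show Measurable fun φ => G (r, φ) from hGm.comp measurable_prodMk_left)]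
  refine lintegral_congr fun φ => ?_
  simp only [hG, psiIntegrand]
  rw [ENNReal.ofReal_mul (by positivity), ENNReal.ofReal_mul zero_le_two, mul_assoc]
  simp

/-- The integrand is nonnegative, so absolute convergence is finiteness of the equal plane integral.
-/
lemma psiConverges (hα : 2 < α) (hA : 0 ≤ A) (hB : 0 ≤ B) :
    PsiConverges (radialAngularLoss α A z) (radialLoss α B) := by
  refine ⟨(measurable_psiIntegrand z).aestronglyMeasurable, ?_⟩
  rw [hasFiniteIntegral_iff_ofReal]
  · rw [← lintegral_one_sub_fadingFactor_eq]
    exact lintegral_one_sub_fadingFactor_lt_top z hα hA hB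
  · refine (ae_restrict_iff' (measurableSet_Ioi.prod measurableSet_Ioc)).2 (ae_of_all _ ?_)
    exact fun p hp => psiIntegrand_nonneg z hA hB (Set.mem_Ioi.1 hp.1).le p.2

lemma lintegral_one_sub_fadingFactor (hα : 2 < α) (hA : 0 ≤ A) (hB : 0 ≤ B) :
    ∫⁻ y, ENNReal.ofReal (1 - fadingFactor α A B z y) =
      ENNReal.ofReal (Psi (radialAngularLoss α A z) (radialLoss α B)) := by
  have hc := psiConverges z hα hA hB
  have hnn : 0 ≤ᵐ[volume.restrict (Set.Ioi (0 : ℝ) ×ˢ Set.Ioc (0 : ℝ) Real.pi)]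
      fun p => psiIntegrand (radialAngularLoss α A z) (radialLoss α B) p.1 p.2 :=
    (ae_restrict_iff' (measurableSet_Ioi.prod measurableSet_Ioc)).2
      (ae_of_all _ fun p hp => psiIntegrand_nonneg z hA hB (Set.mem_Ioi.1 hp.1).le p.2)
  rw [lintegral_one_sub_fadingFactor_eq, ← ofReal_integral_eq_lintegral_ofReal hc hnn, Psi]
  congr 1
  unfold PsiConverges at hc
  rw [Measure.volume_eq_prod] at hc ⊢
  rw [setIntegral_prod _ hc]
  simp_rw [intervalIntegral.integral_of_le Real.pi_pos.le]

lemma Psi_nonneg (hA : 0 ≤ A) (hB : 0 ≤ B) :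
    0 ≤ Psi (radialAngularLoss α A z) (radialLoss α B) :=
  setIntegral_nonneg measurableSet_Ioi fun _ hr =>
    intervalIntegral.integral_nonneg Real.pi_pos.le fun φ _ =>
      psiIntegrand_nonneg z hA hB (Set.mem_Ioi.1 hr).le φ

end FadingFactor

/-! ### Conditioning and independence. -/

section Independence

variable {Ω E F G : Type*} [MeasurableSpace Ω] [MeasurableSpace E] [MeasurableSpace F]
  [MeasurableSpace G] {P : Measure Ω} [IsProbabilityMeasure P]

lemma lintegral_comp_prodMk_of_indepFun {X : Ω → E} {Y : Ω → F} (hX : Measurable X)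
    (hY : Measurable Y) (hXY : IndepFun X Y P) {f : E × F → ℝ≥0∞} (hf : Measurable f) :
    ∫⁻ ω, f (X ω, Y ω) ∂P = ∫⁻ ω, ∫⁻ ω', f (X ω, Y ω') ∂P ∂P := by
  have := Measure.isProbabilityMeasure_map (μ := P) hY.aemeasurable
  rw [← lintegral_map hf (hX.prodMk hY),
    (indepFun_iff_map_prod_eq_prod_map_map hX.aemeasurable hY.aemeasurable).1 hXY,
    lintegral_prod _ hf.aemeasurable, lintegral_map hf.lintegral_prod_right' hX]
  refine lintegral_congr fun ω => ?_
  exact lintegral_map (f := fun y => f (X ω, y)) (hf.comp measurable_prodMk_left) hY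

lemma measure_prodMk_mem_of_indepFun {X : Ω → E} {Y : Ω → F} (hX : Measurable X)
    (hY : Measurable Y) (hXY : IndepFun X Y P) {s : Set (E × F)} (hs : MeasurableSet s) :
    P {ω | (X ω, Y ω) ∈ s} = ∫⁻ ω, P {ω' | (X ω, Y ω') ∈ s} ∂P := by
  have h := lintegral_comp_prodMk_of_indepFun hX hY hXY (f := s.indicator 1)
    (measurable_one.indicator hs)
  have h1 : ∫⁻ ω, s.indicator 1 (X ω, Y ω) ∂P = P {ω | (X ω, Y ω) ∈ s} :=
    lintegral_indicator_one (hX.prodMk hY hs)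
  rw [← h1, h]
  exact lintegral_congr fun ω => lintegral_indicator_one ((measurable_const.prodMk hY) hs)

/-- Freeze `X`: the pair (`U`, `V`) keeps its law, and `U` splits off. It will be used with `U` the
link gains, `X` the locations and `V` the interferer gains. -/
lemma indepFun_prodMk_right_of_indepFun {X : Ω → E} {U : Ω → F} {V : Ω → G} (hX : Measurable X)
    (hU : Measurable U) (hV : Measurable V) (h : IndepFun X (fun ω => (U ω, V ω)) P)
    (hUV : IndepFun U V P) : IndepFun U (fun ω => (X ω, V ω)) P := by
  rw [indepFun_iff_measure_inter_preimage_eq_mul]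
  intro s t hs ht
  have h1 := measure_prodMk_mem_of_indepFun hX (hU.prodMk hV) h
    (s := {p | p.2.1 ∈ s ∧ (p.1, p.2.2) ∈ t})
    ((hs.preimage (by fun_prop)).inter (ht.preimage (by fun_prop)))
  have hXV : IndepFun X V P := h.comp measurable_id measurable_snd
  calc P (U ⁻¹' s ∩ (fun ω => (X ω, V ω)) ⁻¹' t)
      = ∫⁻ ω, P (U ⁻¹' s ∩ V ⁻¹' (Prod.mk (X ω) ⁻¹' t)) ∂P := h1
    _ = ∫⁻ ω, P (U ⁻¹' s) * P {ω' | (X ω, V ω') ∈ t} ∂P :=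
        lintegral_congr fun ω =>
          hUV.measure_inter_preimage_eq_mul _ _ hs (measurable_prodMk_left ht)
    _ = P (U ⁻¹' s) * P ((fun ω => (X ω, V ω)) ⁻¹' t) := by
        rw [lintegral_const_mul' _ _ (measure_ne_top _ _),
          ← measure_prodMk_mem_of_indepFun hX hV hXV ht]
        rfl

lemma lintegral_expNeg_tsum_of_iIndepFun {ι : Type*} [Countable ι] {Y : ι → Ω → ℝ≥0∞}
    {c : ι → ℝ≥0∞} (hY : iIndepFun Y P) (hm : ∀ i, Measurable (Y i))
    (hc : ∀ i, ∫⁻ ω, expNeg (Y i ω) ∂P = expNeg (c i)) :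
    ∫⁻ ω, expNeg (∑' i, Y i ω) ∂P = expNeg (∑' i, c i) := by
  have hL : Tendsto (fun s : Finset ι => ∫⁻ ω, expNeg (∑ i ∈ s, Y i ω) ∂P) atTop
      (𝓝 (∫⁻ ω, expNeg (∑' i, Y i ω) ∂P)) := by
    -- Countability of the index set makes the filter of finite subsets countably generated, as
    -- dominated convergence requires.
    refine tendsto_lintegral_filter_of_dominated_convergence (fun _ => 1)
      (Eventually.of_forall fun s => by fun_prop)
      (Eventually.of_forall fun s => ae_of_all _ fun ω => expNeg_le_one _) (by simp)
      (ae_of_all _ fun ω => ?_)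
    exact (continuous_expNeg.tendsto _).comp ENNReal.summable.hasSum
  have hR : Tendsto (fun s : Finset ι => expNeg (∑ i ∈ s, c i)) atTop
      (𝓝 (expNeg (∑' i, c i))) :=
    (continuous_expNeg.tendsto _).comp ENNReal.summable.hasSum
  refine tendsto_nhds_unique hL (hR.congr fun s => ?_)
  simp_rw [expNeg_sum]
  rw [lintegral_prod_eq_prod_lintegral_of_indepFun s (fun i ω => expNeg (Y i ω))
    (hY.comp (fun _ => expNeg) fun _ => measurable_expNeg)
    fun i => measurable_expNeg.comp (hm i)]
  exact Finset.prod_congr rfl fun i _ => (hc i).symm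

end Independence

/-! ### Joint Laplace transform of the interferences. -/

/-- The interference at `y` from interferers at the locations `ξ i` with fading gains `γ i`. -/
noncomputable def totalPower (α : ℝ) (y : Plane) (ξ : ℕ → Plane) (γ : ℕ → ℝ) : ℝ≥0∞ :=
  ∑' i, ENNReal.ofReal (γ i * pathLoss α ‖ξ i - y‖)

lemma measurable_totalPower {E : Type*} [MeasurableSpace E] (α : ℝ) (y : Plane)
    {ξ : E → ℕ → Plane} {γ : E → ℕ → ℝ} (hξ : Measurable ξ) (hγ : Measurable γ) :
    Measurable fun p => totalPower α y (ξ p) (γ p) := by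
  have := measurable_pathLoss α
  unfold totalPower
  fun_prop

lemma measurable_prodMk_sequences {Ω : Type*} [MeasurableSpace Ω] {g h : ℕ → Ω → ℝ}
    (hg : ∀ i, Measurable (g i)) (hh : ∀ i, Measurable (h i)) :
    Measurable fun ω => ((fun i => g i ω), (fun i => h i ω)) :=
  (measurable_pi_lambda _ hg).prodMk (measurable_pi_lambda _ hh)

namespace IsRayleighNetwork

variable {Ω : Type*} [MeasurableSpace Ω] {P : Measure Ω}
  {lam η : ℝ} {x : ℕ → Ω → Plane} {usr usd urd : Ω → ℝ} {g h : ℕ → Ω → ℝ}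

lemma measurable_locations (hnet : IsRayleighNetwork P lam η x usr usd urd g h) :
    Measurable fun ω i => x i ω :=
  measurable_pi_lambda _ hnet.measurable_location

lemma measurable_links (hnet : IsRayleighNetwork P lam η x usr usd urd g h) :
    Measurable fun ω => (usr ω, usd ω, urd ω) :=
  (hnet.measurable_gain .sr).prodMk
    ((hnet.measurable_gain .sd).prodMk (hnet.measurable_gain .rd))

lemma measurable_interfererGains (hnet : IsRayleighNetwork P lam η x usr usd urd g h) :
    Measurable fun ω => ((fun i => g i ω), (fun i => h i ω)) :=
  measurable_prodMk_sequences (fun i => hnet.measurable_gain (.toRelay i))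
    (fun i => hnet.measurable_gain (.toDest i))

/-- The two groups of gains are indexed by complementary sets of links, which generate independent
σ-algebras. -/
lemma indepFun_links_interfererGains [IsProbabilityMeasure P]
    (hnet : IsRayleighNetwork P lam η x usr usd urd g h) :
    IndepFun (fun ω => (usr ω, usd ω, urd ω)) (fun ω => ((fun i => g i ω), (fun i => h i ω))) P := by
  let m : Link → MeasurableSpace Ω := fun k =>
    MeasurableSpace.comap (gains usr usd urd g h k) inferInstance
  let S : Set Link := {.sr, .sd, .rd}
  have hind : Indep (⨆ k ∈ S, m k) (⨆ k ∈ Sᶜ, m k) P :=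
    indep_iSup_of_disjoint (fun k => (hnet.measurable_gain k).comap_le) hnet.indep_gains
      disjoint_compl_right
  have key : ∀ (T : Set Link) (k : Link), k ∈ T →
      Measurable[⨆ k ∈ T, m k] (gains usr usd urd g h k) := fun T k hk =>
    Measurable.mono (comap_measurable _) (le_iSup₂ (f := fun k (_ : k ∈ T) => m k) k hk) le_rfl
  rw [IndepFun_iff_Indep]
  refine indep_of_indep_of_le hind ?_ ?_
  · refine Measurable.comap_le ?_
    exact (key S .sr (by simp [S])).prodMk
      ((key S .sd (by simp [S])).prodMk (key S .rd (by simp [S])))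
  · refine Measurable.comap_le ?_
    exact @measurable_prodMk_sequences _ (⨆ k ∈ Sᶜ, m k) g h
      (fun i => key Sᶜ (.toRelay i) (by simp [S])) (fun i => key Sᶜ (.toDest i) (by simp [S]))

lemma indepFun_locations_gains (hnet : IsRayleighNetwork P lam η x usr usd urd g h) :
    IndepFun (fun ω i => x i ω) (fun ω => ((usr ω, usd ω, urd ω),
      ((fun i => g i ω), (fun i => h i ω)))) P :=
  hnet.indep_location.comp measurable_id
    (ψ := fun γ : Link → ℝ => ((γ .sr, γ .sd, γ .rd),
      ((fun i => γ (.toRelay i)), (fun i => γ (.toDest i))))) (by fun_prop)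

lemma measurable_interferences (hnet : IsRayleighNetwork P lam η x usr usd urd g h) (α : ℝ)
    (y z : Plane) : Measurable fun ω => (interference α x g y ω, interference α x h z ω) :=
  (measurable_totalPower α y hnet.measurable_locations hnet.measurable_interfererGains.fst).prodMk
    (measurable_totalPower α z hnet.measurable_locations hnet.measurable_interfererGains.snd)

lemma indepFun_links_interferences [IsProbabilityMeasure P]
    (hnet : IsRayleighNetwork P lam η x usr usd urd g h) (α : ℝ)
    (y z : Plane) : IndepFun (fun ω => (usr ω, usd ω, urd ω))
      (fun ω => (interference α x g y ω, interference α x h z ω)) P := by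
  have hi := indepFun_prodMk_right_of_indepFun hnet.measurable_locations hnet.measurable_links
    hnet.measurable_interfererGains hnet.indepFun_locations_gains
    hnet.indepFun_links_interfererGains
  exact hi.comp (φ := id) (ψ := fun p => (totalPower α y p.1 p.2.1, totalPower α z p.1 p.2.2))
    measurable_id ((measurable_totalPower α y measurable_fst measurable_snd.fst).prodMk
      (measurable_totalPower α z measurable_fst measurable_snd.snd))

lemma lintegral_comp_gain (hnet : IsRayleighNetwork P lam η x usr usd urd g h) (k : Link)
    {f : ℝ → ℝ≥0∞} (hf : Measurable f) :
    ∫⁻ ω, f (gains usr usd urd g h k ω) ∂P = ∫⁻ u, f u ∂expMeasure η := by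
  rw [← hnet.exponential k, lintegral_map hf (hnet.measurable_gain k)]

/-- The Laplace transform of the interferences, conditionally on the locations. -/
lemma lintegral_expNeg_totalPower [IsProbabilityMeasure P]
    (hnet : IsRayleighNetwork P lam η x usr usd urd g h)
    (hη : 0 < η) {α A B : ℝ} (hA : 0 ≤ A) (hB : 0 ≤ B) (z : Plane) (ξ : ℕ → Plane) :
    ∫⁻ ω, expNeg (ENNReal.ofReal (η * A) * totalPower α z ξ (fun i => g i ω) +
      ENNReal.ofReal (η * B) * totalPower α 0 ξ (fun i => h i ω)) ∂P =
      expNeg (∑' i, ENNReal.ofReal (-Real.log (fadingFactor α A B z (ξ i)))) := by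
  -- Merging both families of interferer gains lets a single infinite product handle them.
  let e : ℕ ⊕ ℕ → Link := Sum.elim Link.toRelay Link.toDest
  have he : Function.Injective e := by
    rintro (i | i) (j | j) hij <;> simp_all [e]
  let C : ℕ ⊕ ℕ → ℝ := Sum.elim (fun _ => A) (fun _ => B)
  let l : ℕ ⊕ ℕ → ℝ := Sum.elim (fun i => pathLoss α ‖ξ i - z‖) (fun i => pathLoss α ‖ξ i - 0‖)
  have hC : ∀ k, 0 ≤ C k := by rintro (i | i) <;> assumption
  have hl : ∀ k, 0 < l k := by rintro (i | i) <;> exact pathLoss_pos α (norm_nonneg _)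
  have hCl : ∀ k, 1 ≤ 1 + C k * l k := fun k => by
    have := mul_nonneg (hC k) (hl k).le
    linarith
  have hmeas : ∀ k, Measurable fun u : ℝ => ENNReal.ofReal (η * C k) * ENNReal.ofReal (u * l k) :=
    fun k => by fun_prop
  have key := lintegral_expNeg_tsum_of_iIndepFun
    (Y := fun k ω => ENNReal.ofReal (η * C k) *
      ENNReal.ofReal (gains usr usd urd g h (e k) ω * l k))
    -- Writing 1/(1 + Cl) as e^{-log(1 + Cl)} turns the product into a sum over the points.
    (c := fun k => ENNReal.ofReal (Real.log (1 + C k * l k)))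
    ((hnet.indep_gains.precomp he).comp _ hmeas)
    (fun k => (hmeas k).comp (hnet.measurable_gain (e k)))
    (fun k => by
      refine (hnet.lintegral_comp_gain (e k) (measurable_expNeg.comp (hmeas k))).trans ?_
      simp only [Function.comp_apply]
      rw [lintegral_expNeg_expMeasure hη (hC k) (hl k).le, expNeg_ofReal (Real.log_nonneg (hCl k)),
        Real.exp_neg, Real.exp_log (by linarith [hCl k]), one_div])
  simp_rw [ENNReal.summable.tsum_sum ENNReal.summable] at key
  simp only [C, l, e, Sum.elim_inl, Sum.elim_inr, ENNReal.tsum_mul_left] at key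
  refine Eq.trans key ?_
  rw [← ENNReal.tsum_add]
  congr 2 with i
  have h1 := hCl (.inl i)
  have h2 := hCl (.inr i)
  simp only [C, l, Sum.elim_inl, Sum.elim_inr] at h1 h2
  rw [← ENNReal.ofReal_add (Real.log_nonneg h1) (Real.log_nonneg h2),
    ← Real.log_mul (by positivity) (by positivity), ← Real.log_inv, fadingFactor, one_div, inv_inv,
    sub_zero]

/-- The joint Laplace transform of the interferences at `z` and at the origin. -/
theorem lintegral_expNeg_interference [IsProbabilityMeasure P]
    (hnet : IsRayleighNetwork P lam η x usr usd urd g h)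
    (hlam : 0 < lam) (hη : 0 < η) {α A B : ℝ} (hα : 2 < α) (hA : 0 ≤ A) (hB : 0 ≤ B) (z : Plane) :
    ∫⁻ ω, expNeg (ENNReal.ofReal (η * A) * interference α x g z ω +
      ENNReal.ofReal (η * B) * interference α x h 0 ω) ∂P =
      ENNReal.ofReal (Real.exp (-lam * Psi (radialAngularLoss α A z) (radialLoss α B))) := by
  have hind : IndepFun (fun ω i => x i ω) (fun ω => ((fun i => g i ω), (fun i => h i ω))) P :=
    hnet.indepFun_locations_gains.comp measurable_id measurable_snd
  have hF : Measurable fun y => ENNReal.ofReal (-Real.log (fadingFactor α A B z y)) :=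
    (Real.measurable_log.comp (measurable_fadingFactor z)).neg.ennreal_ofReal
  have h1 := lintegral_comp_prodMk_of_indepFun hnet.measurable_locations
    hnet.measurable_interfererGains hind
    (f := fun p => expNeg (ENNReal.ofReal (η * A) * totalPower α z p.1 p.2.1 +
      ENNReal.ofReal (η * B) * totalPower α 0 p.1 p.2.2))
    (measurable_expNeg.comp
      (((measurable_totalPower α z (by fun_prop) (by fun_prop)).const_mul _).add
        ((measurable_totalPower α 0 (by fun_prop) (by fun_prop)).const_mul _)))
  simp only [hnet.lintegral_expNeg_totalPower hη hA hB z] at h1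
  have : SigmaFinite (ENNReal.ofReal lam • (volume : Measure Plane)) :=
    inferInstanceAs (SigmaFinite (lam.toNNReal • (volume : Measure Plane)))
  have h2 := hnet.poisson.lintegral_expNeg hF
  -- Integrating against the counting measure is summing over the interferers.
  simp only [pointProcess, lintegral_sum_measure, lintegral_dirac' _ hF] at h2
  refine h1.trans (h2.trans ?_)
  have h3 : ∀ y, 1 - expNeg (ENNReal.ofReal (-Real.log (fadingFactor α A B z y))) =
      ENNReal.ofReal (1 - fadingFactor α A B z y) := by
    intro y
    have hp := fadingFactor_pos (α := α) z hA hB y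
    have hle := fadingFactor_le_one (α := α) z hA hB y
    rw [expNeg_ofReal (neg_nonneg.2 (Real.log_nonpos hp.le hle)), neg_neg, Real.exp_log hp,
      ENNReal.ofReal_sub _ hp.le, ENNReal.ofReal_one]
  simp_rw [h3]
  rw [lintegral_smul_measure, lintegral_one_sub_fadingFactor z hα hA hB, smul_eq_mul,
    ← ENNReal.ofReal_mul hlam.le, expNeg_ofReal (mul_nonneg hlam.le (Psi_nonneg z hA hB)), neg_mul]

end IsRayleighNetwork

/-! ### Joint success probabilities. -/

lemma ofReal_div_mul_ofReal_mul {η d : ℝ} (hη : 0 < η) (hd : 0 < d) (t : ℝ) (v : ℝ≥0∞) :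
    ENNReal.ofReal (η / d) * (ENNReal.ofReal t * v) = ENNReal.ofReal (η * (t / d)) * v := by
  rw [← mul_assoc, ← ENNReal.ofReal_mul (by positivity), mul_div_assoc', div_mul_eq_mul_div]

namespace IsRayleighNetwork

variable {Ω : Type*} [MeasurableSpace Ω] {P : Measure Ω}
  {lam η : ℝ} {x : ℕ → Ω → Plane} {usr usd urd : Ω → ℝ} {g h : ℕ → Ω → ℝ}

lemma measure_gain_mem (hnet : IsRayleighNetwork P lam η x usr usd urd g h) (k : Link) {s : Set ℝ}
    (hs : MeasurableSet s) : P (gains usr usd urd g h k ⁻¹' s) = expMeasure η s := by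
  rw [← hnet.exponential k, Measure.map_apply (hnet.measurable_gain k) hs]

lemma ae_gain_pos (hnet : IsRayleighNetwork P lam η x usr usd urd g h) (hη : 0 < η) (k : Link) :
    ∀ᵐ ω ∂P, 0 < gains usr usd urd g h k ω := by
  have := ae_expMeasure_pos hη
  rw [← hnet.exponential k] at this
  exact ae_of_ae_map (hnet.measurable_gain k).aemeasurable this

lemma measure_usr_inter [IsProbabilityMeasure P]
    (hnet : IsRayleighNetwork P lam η x usr usd urd g h) {s : Set ℝ}
    {t : Set (ℝ × ℝ)} (hs : MeasurableSet s) (ht : MeasurableSet t) :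
    P {ω | usr ω ∈ s ∧ (usd ω, urd ω) ∈ t} =
      expMeasure η s * ((expMeasure η).prod (expMeasure η)) t := by
  have h1 : IndepFun (fun ω => (usd ω, urd ω)) usr P :=
    hnet.indep_gains.indepFun_prodMk hnet.measurable_gain .sd .rd .sr (by simp) (by simp)
  have h2 : IndepFun usd urd P :=
    hnet.indep_gains.indepFun (i := .sd) (j := .rd) (by simp)
  have hsd : Measurable usd := hnet.measurable_gain .sd
  have hrd : Measurable urd := hnet.measurable_gain .rd
  have h3 : P.map (fun ω => (usd ω, urd ω)) = (expMeasure η).prod (expMeasure η) := by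
    rw [(indepFun_iff_map_prod_eq_prod_map_map hsd.aemeasurable hrd.aemeasurable).1 h2]
    exact congrArg₂ Measure.prod (hnet.exponential .sd) (hnet.exponential .rd)
  rw [← h3, Measure.map_apply (hsd.prodMk hrd) ht, ← hnet.measure_gain_mem .sr hs]
  exact h1.symm.measure_inter_preimage_eq_mul _ _ hs ht

/-- Conditioning the link gains on the interferences. -/
lemma measure_link_events [IsProbabilityMeasure P]
    (hnet : IsRayleighNetwork P lam η x usr usd urd g h) (hη : 0 < η)
    (α : ℝ) (y z : Plane) {a s t : ℝ} (ha : 0 < a)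
    {p : ℝ × ℝ → ℝ} (hp : Measurable p) :
    P {ω | ENNReal.ofReal s * interference α x g y ω ≤ ENNReal.ofReal (usr ω * a) ∧
        ENNReal.ofReal t * interference α x h z ω ≤ ENNReal.ofReal (p (usd ω, urd ω))} =
      ∫⁻ ω, expNeg (ENNReal.ofReal (η * (s / a)) * interference α x g y ω) *
        ((expMeasure η).prod (expMeasure η))
          {q | ENNReal.ofReal t * interference α x h z ω ≤ ENNReal.ofReal (p q)} ∂P := by
  have hmeas₁ : MeasurableSet {q : (ℝ≥0∞ × ℝ≥0∞) × (ℝ × ℝ × ℝ) |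
      ENNReal.ofReal s * q.1.1 ≤ ENNReal.ofReal (q.2.1 * a)} :=
    measurableSet_le (by fun_prop) (by fun_prop)
  have hmeas₂ : MeasurableSet {q : (ℝ≥0∞ × ℝ≥0∞) × (ℝ × ℝ × ℝ) |
      ENNReal.ofReal t * q.1.2 ≤ ENNReal.ofReal (p q.2.2)} :=
    measurableSet_le (by fun_prop) (by fun_prop)
  refine (measure_prodMk_mem_of_indepFun (hnet.measurable_interferences α y z)
    hnet.measurable_links (hnet.indepFun_links_interferences α y z).symm
    (hmeas₁.inter hmeas₂)).trans ?_
  refine lintegral_congr fun ω => ?_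
  generalize interference α x g y ω = u
  generalize interference α x h z ω = v
  refine (hnet.measure_usr_inter (s := {w | ENNReal.ofReal s * u ≤ ENNReal.ofReal (w * a)})
    (t := {q | ENNReal.ofReal t * v ≤ ENNReal.ofReal (p q)})
    (measurableSet_le (by fun_prop) (by fun_prop))
    (measurableSet_le (by fun_prop) (by fun_prop))).trans ?_
  rw [expMeasure_le_ofReal_mul hη ha, ofReal_div_mul_ofReal_mul hη ha]

lemma measurable_exponent (hnet : IsRayleighNetwork P lam η x usr usd urd g h) (α A B : ℝ)
    (y z : Plane) : Measurable fun ω => expNeg (ENNReal.ofReal A * interference α x g y ω +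
      ENNReal.ofReal B * interference α x h z ω) :=
  measurable_expNeg.comp
    (((hnet.measurable_interferences α y z).fst.const_mul _).add
      ((hnet.measurable_interferences α y z).snd.const_mul _))

/-- The joint success probability of the source-relay and the source-destination link. -/
theorem measureReal_relay_direct [IsProbabilityMeasure P]
    (hnet : IsRayleighNetwork P lam η x usr usd urd g h)
    (hlam : 0 < lam) (hη : 0 < η) {α a b s t : ℝ} (hα : 2 < α) (ha : 0 < a) (hb : 0 < b)
    (hs : 0 ≤ s) (ht : 0 ≤ t) (z : Plane) :
    P.real {ω | ENNReal.ofReal s * interference α x g z ω ≤ ENNReal.ofReal (usr ω * a) ∧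
        ENNReal.ofReal t * interference α x h 0 ω ≤ ENNReal.ofReal (usd ω * b)} =
      Real.exp (-lam * Psi (radialAngularLoss α (s / a) z) (radialLoss α (t / b))) := by
  have := isProbabilityMeasure_expMeasure hη
  have h1 := hnet.measure_link_events hη α z 0 (s := s) (t := t) ha (p := fun q => q.1 * b)
    (by fun_prop)
  have h2 : ∀ v : ℝ≥0∞, ((expMeasure η).prod (expMeasure η))
      {q | ENNReal.ofReal t * v ≤ ENNReal.ofReal (q.1 * b)} =
      expNeg (ENNReal.ofReal (η * (t / b)) * v) := by
    intro v
    have : {q : ℝ × ℝ | ENNReal.ofReal t * v ≤ ENNReal.ofReal (q.1 * b)} =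
        {w | ENNReal.ofReal t * v ≤ ENNReal.ofReal (w * b)} ×ˢ Set.univ := by
      ext; simp
    rw [this, Measure.prod_prod, measure_univ, mul_one, expMeasure_le_ofReal_mul hη hb,
      ofReal_div_mul_ofReal_mul hη hb]
  simp_rw [h2, ← expNeg_add] at h1
  rw [Measure.real, h1, hnet.lintegral_expNeg_interference hlam hη hα (by positivity)
    (by positivity), ENNReal.toReal_ofReal (Real.exp_pos _).le]

/-- The joint success probability of the source-relay link and of the combined link. -/
theorem measureReal_relay_combined [IsProbabilityMeasure P]
    (hnet : IsRayleighNetwork P lam η x usr usd urd g h)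
    (hlam : 0 < lam) (hη : 0 < η) {α a b c s t : ℝ} (hα : 2 < α) (ha : 0 < a) (hb : 0 < b)
    (hc : 0 < c) (hbc : b ≠ c) (hs : 0 ≤ s) (ht : 0 ≤ t) (z : Plane) :
    P.real {ω | ENNReal.ofReal s * interference α x g z ω ≤ ENNReal.ofReal (usr ω * a) ∧
        ENNReal.ofReal t * interference α x h 0 ω ≤ ENNReal.ofReal (usd ω * b + urd ω * c)} =
      b / (b - c) * Real.exp (-lam * Psi (radialAngularLoss α (s / a) z) (radialLoss α (t / b))) -
      c / (b - c) *
        Real.exp (-lam * Psi (radialAngularLoss α (s / a) z) (radialLoss α (t / c))) := by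
  have := isProbabilityMeasure_expMeasure hη
  have hm := hnet.measurable_interferences α z 0
  have h1 := hnet.measure_link_events hη α z 0 (s := s) (t := t) ha (p := fun q => q.1 * b + q.2 * c)
    (by fun_prop)
  have hsec : Measurable fun v : ℝ≥0∞ => ((expMeasure η).prod (expMeasure η))
      {q | ENNReal.ofReal t * v ≤ ENNReal.ofReal (q.1 * b + q.2 * c)} :=
    measurable_measure_prodMk_left (ν := (expMeasure η).prod (expMeasure η))
      (s := {q : ℝ≥0∞ × (ℝ × ℝ) |
        ENNReal.ofReal t * q.1 ≤ ENNReal.ofReal (q.2.1 * b + q.2.2 * c)})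
      (measurableSet_le (by fun_prop) (by fun_prop))
  have h2 : ∀ d, 0 < d → ∫ ω, (expNeg (ENNReal.ofReal (η * (s / a)) * interference α x g z ω +
      ENNReal.ofReal (η * (t / d)) * interference α x h 0 ω)).toReal ∂P =
      Real.exp (-lam * Psi (radialAngularLoss α (s / a) z) (radialLoss α (t / d))) := by
    intro d hd
    rw [integral_toReal (hnet.measurable_exponent α _ _ z 0).aemeasurable
      (ae_of_all _ fun ω => (expNeg_ne_top _).lt_top),
      hnet.lintegral_expNeg_interference hlam hη hα (by positivity) (by positivity),
      ENNReal.toReal_ofReal (Real.exp_pos _).le]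
  have hint : ∀ d, Integrable (fun ω => (expNeg (ENNReal.ofReal (η * (s / a)) *
      interference α x g z ω + ENNReal.ofReal (η * (t / d)) * interference α x h 0 ω)).toReal) P := by
    intro d
    refine integrable_toReal_of_lintegral_ne_top
      (hnet.measurable_exponent α _ _ z 0).aemeasurable ?_
    refine ((lintegral_mono fun ω => expNeg_le_one _).trans_lt ?_).ne
    simp
  have hm' : Measurable fun ω => expNeg (ENNReal.ofReal (η * (s / a)) * interference α x g z ω) *
      ((expMeasure η).prod (expMeasure η))
        {q | ENNReal.ofReal t * interference α x h 0 ω ≤ ENNReal.ofReal (q.1 * b + q.2 * c)} :=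
    (measurable_expNeg.comp (hm.fst.const_mul _)).mul (hsec.comp hm.snd)
  -- Real integrals are needed here: one of the coefficients b/(b - c) and -c/(b - c) is negative.
  rw [Measure.real, h1, ← integral_toReal hm'.aemeasurable
    (ae_of_all _ fun ω => ENNReal.mul_lt_top (expNeg_ne_top _).lt_top (measure_lt_top _ _)),
    ← h2 b hb, ← h2 c hc, ← integral_const_mul, ← integral_const_mul,
    ← integral_sub ((hint b).const_mul _) ((hint c).const_mul _)]
  refine integral_congr_ae (ae_of_all _ fun ω => ?_)
  have h3 := expMeasure_prod_le_ofReal_add hη hb hc hbc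
    (ENNReal.ofReal t * interference α x h 0 ω)
  rw [Measure.real, ofReal_div_mul_ofReal_mul hη hb, ofReal_div_mul_ofReal_mul hη hc] at h3
  simp only [expNeg_add, ENNReal.toReal_mul]
  rw [h3]
  ring

end IsRayleighNetwork

/-! ### From success probabilities to outage probabilities. -/

/-- Positivity of `u` settles the case of zero interference, where u/0 = ∞ but 0/0 = 0. -/
lemma ofReal_le_ofReal_div_iff {β u : ℝ} (hu : 0 < u) (I : ℝ≥0∞) :
    ENNReal.ofReal β ≤ ENNReal.ofReal u / I ↔ ENNReal.ofReal β * I ≤ ENNReal.ofReal u :=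
  ENNReal.le_div_iff_mul_le (Or.inr (by simpa using hu)) (Or.inr ENNReal.ofReal_ne_top)

lemma radialAngularLoss_zero (α : ℝ) (z : Plane) :
    radialAngularLoss α 0 z = fun _ _ => 0 := by
  funext r φ
  simp [radialAngularLoss]

lemma radialLoss_zero (α : ℝ) : radialLoss α 0 = fun _ => 0 := by
  funext r
  simp [radialLoss]

lemma radialAngularLoss_div_pathLoss (α β : ℝ) (xs xr : Plane) :
    radialAngularLoss α (β / pathLoss α ‖xs - xr‖) xr = fun r φ => β * lsr α xs xr r φ := by
  funext r φ
  simp only [radialAngularLoss, lsr, pathLoss, div_inv_eq_mul, mul_div_assoc]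

lemma radialLoss_div_pathLoss_lsd (α β : ℝ) (y : Plane) :
    radialLoss α (β / pathLoss α ‖y‖) = fun r => β * lsd α y r := by
  funext r
  simp only [radialLoss, lsd, pathLoss, div_inv_eq_mul, mul_div_assoc]

end SDF

theorem proposition1 {Ω : Type*} [MeasurableSpace Ω] (P : Measure Ω) [IsProbabilityMeasure P]
    (α lam β η : ℝ) (hα : 2 < α) (hlam : 0 < lam) (hβ : 0 < β) (hη : 0 < η)
    (xs xr : SDF.Plane) (hne : ‖xs‖ ≠ ‖xr‖)
    (x : ℕ → Ω → SDF.Plane) (usr usd urd : Ω → ℝ) (g h : ℕ → Ω → ℝ)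
    (hnet : SDF.IsRayleighNetwork P lam η x usr usd urd g h) :
    (SDF.PsiConverges (fun _ _ => 0) (fun r => β / 2 * SDF.lsd α xs r) ∧
      SDF.PsiConverges (fun r φ => β * SDF.lsr α xs xr r φ) (fun _ => 0) ∧
      SDF.PsiConverges (fun r φ => β * SDF.lsr α xs xr r φ) (fun r => β / 2 * SDF.lsd α xs r) ∧
      SDF.PsiConverges (fun r φ => β * SDF.lsr α xs xr r φ) (fun r => β * SDF.lsd α xs r) ∧
      SDF.PsiConverges (fun r φ => β * SDF.lsr α xs xr r φ) (fun r => β * SDF.lrd α xr r)) ∧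
    SDF.qBC α P β xs xr x usr usd g h =
      1 - Real.exp (-lam * SDF.Psi (fun _ _ => 0) (fun r => β / 2 * SDF.lsd α xs r))
        - Real.exp (-lam * SDF.Psi (fun r φ => β * SDF.lsr α xs xr r φ) (fun _ => 0))
        + Real.exp (-lam * SDF.Psi (fun r φ => β * SDF.lsr α xs xr r φ)
            (fun r => β / 2 * SDF.lsd α xs r)) ∧
    SDF.qMAC α P β xs xr x usr usd urd g h =
      Real.exp (-lam * SDF.Psi (fun r φ => β * SDF.lsr α xs xr r φ) (fun _ => 0))
        - SDF.mu1 α xs xr * Real.exp (-lam * SDF.Psi (fun r φ => β * SDF.lsr α xs xr r φ)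
            (fun r => β * SDF.lsd α xs r))
        + SDF.mu2 α xs xr * Real.exp (-lam * SDF.Psi (fun r φ => β * SDF.lsr α xs xr r φ)
            (fun r => β * SDF.lrd α xr r)) := by
  have ha : 0 < SDF.pathLoss α ‖xs - xr‖ := SDF.pathLoss_pos α (norm_nonneg _)
  have hb : 0 < SDF.pathLoss α ‖xs‖ := SDF.pathLoss_pos α (norm_nonneg _)
  have hc : 0 < SDF.pathLoss α ‖xr‖ := SDF.pathLoss_pos α (norm_nonneg _)
  have hbc : SDF.pathLoss α ‖xs‖ ≠ SDF.pathLoss α ‖xr‖ := fun heq =>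
    hne (SDF.pathLoss_injOn (by linarith) (norm_nonneg xs) (norm_nonneg xr) heq)
  have hlrd : (fun r => β * SDF.lrd α xr r) = fun r => β * SDF.lsd α xr r := rfl
  -- All five integrals become instances of one family; a zero argument is the case A = 0 or B = 0.
  rw [hlrd, ← SDF.radialAngularLoss_div_pathLoss, ← SDF.radialLoss_div_pathLoss_lsd,
    ← SDF.radialLoss_div_pathLoss_lsd, ← SDF.radialLoss_div_pathLoss_lsd,
    ← SDF.radialAngularLoss_zero α xr, ← SDF.radialLoss_zero α]
  refine ⟨⟨SDF.psiConverges _ hα le_rfl (by positivity), SDF.psiConverges _ hα (by positivity) le_rfl,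
    SDF.psiConverges _ hα (by positivity) (by positivity),
    SDF.psiConverges _ hα (by positivity) (by positivity),
    SDF.psiConverges _ hα (by positivity) (by positivity)⟩, ?_⟩
  have hm := hnet.measurable_interferences α xr 0
  have husr : Measurable usr := hnet.measurable_gain .sr
  have husd : Measurable usd := hnet.measurable_gain .sd
  have hurd : Measurable urd := hnet.measurable_gain .rd
  set R : Set Ω := {ω | ENNReal.ofReal β * SDF.interference α x g xr ω ≤
    ENNReal.ofReal (usr ω * SDF.pathLoss α ‖xs - xr‖)} with hR
  set D : Set Ω := {ω | ENNReal.ofReal β * SDF.interference α x h 0 ω ≤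
    ENNReal.ofReal (usd ω * (2 * SDF.pathLoss α ‖xs‖))} with hD
  set C : Set Ω := {ω | ENNReal.ofReal β * SDF.interference α x h 0 ω ≤
    ENNReal.ofReal (usd ω * SDF.pathLoss α ‖xs‖ + urd ω * SDF.pathLoss α ‖xr‖)} with hC
  have hRm : MeasurableSet R := measurableSet_le (hm.fst.const_mul _) (by fun_prop)
  have hCm : MeasurableSet C := measurableSet_le (hm.snd.const_mul _) (by fun_prop)
  have hDm : MeasurableSet D := measurableSet_le (hm.snd.const_mul _) (by fun_prop)
  have hb2 : 0 < 2 * SDF.pathLoss α ‖xs‖ := by positivity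
  -- The marginals P(R) and P(D) come from the joint formula by setting the other threshold to 0,
  -- which makes that event certain. The doubled path loss in D turns β into β/2.
  have hPR := hnet.measureReal_relay_direct hlam hη hα ha hb2 hβ.le le_rfl xr
  have hPD := hnet.measureReal_relay_direct hlam hη hα ha hb2 le_rfl hβ.le xr
  have hPRD := hnet.measureReal_relay_direct hlam hη hα ha hb2 hβ.le hβ.le xr
  have hPRC := hnet.measureReal_relay_combined hlam hη hα ha hb hc hbc hβ.le hβ.le xr
  simp only [ENNReal.ofReal_zero, zero_mul, zero_le, and_true, true_and, zero_div,
    ← div_div] at hPR hPD hPRD hPRC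
  -- The gains are only almost surely positive, so the events below agree up to null sets.
  have hpos := (hnet.ae_gain_pos hη .sr).and
    ((hnet.ae_gain_pos hη .sd).and (hnet.ae_gain_pos hη .rd))
  simp only [SDF.gains] at hpos
  constructor
  · have hset : {ω | SDF.SIRsd α xs x usd h ω < ENNReal.ofReal β ∧
        SDF.SIRsr α xs xr x usr g ω < ENNReal.ofReal β} =ᵐ[P] ((R ∪ D)ᶜ : Set Ω) := by
      filter_upwards [hpos] with ω hω
      refine propext ?_
      change (_ ∧ _) ↔ ¬ (_ ∨ _)
      rw [not_or, SDF.SIRsd, SDF.SIRsr, ← not_le, ← not_le,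
        SDF.ofReal_le_ofReal_div_iff (mul_pos hω.1 ha),
        SDF.ofReal_le_ofReal_div_iff (by have := hω.2.1; positivity), mul_comm 2, mul_assoc]
      exact and_comm
    have hunion := measureReal_union_add_inter (μ := P) (s := R) hDm
    rw [SDF.qBC, measureReal_congr hset, probReal_compl_eq_one_sub (hRm.union hDm)]
    have hRD : P.real (R ∩ D) = _ := hPRD
    rw [hRD, hPR, hPD] at hunion
    linarith
  · have hset : {ω | SDF.SIRsrd α xs xr x usd urd h ω < ENNReal.ofReal β ∧
        ENNReal.ofReal β ≤ SDF.SIRsr α xs xr x usr g ω} =ᵐ[P] (R \ C : Set Ω) := by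
      filter_upwards [hpos] with ω hω
      refine propext ?_
      change (_ ∧ _) ↔ (_ ∧ ¬ _)
      rw [SDF.SIRsrd, SDF.SIRsr, ← not_le, SDF.ofReal_le_ofReal_div_iff (mul_pos hω.1 ha),
        SDF.ofReal_le_ofReal_div_iff
          (add_pos (mul_pos hω.2.1 hb) (mul_pos hω.2.2 hc))]
      exact and_comm
    have hdiff := measureReal_sdiff_add_inter (μ := P) (s := R) hCm
    rw [SDF.qMAC, measureReal_congr hset]
    have hRC : P.real (R ∩ C) = _ := hPRC
    rw [hRC, hPR] at hdiff
    simp only [SDF.mu1, SDF.mu2]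
    linarith
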